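/- **Model.** All weights are positive reals. For a weighted graph $G=(V,E,w)$ the aspect ratio is $\max_e w(e)/\min_f w(f)$, a matching is a set of pairwise vertex-disjoint edges, and for real $\alpha$ an $\alpha$-approximate maximum weight matching (MWM) is a matching $M$ with $w(M)\ge \alpha\, w(M')$ for every matching $M'$ of $G$. A (deterministic) streaming algorithm reads the weighted edges of a simple graph on the vertex set $\{1,\dots,n\}$, in an arbitrary order, in one or several passes. Its space is the number of bits of memory carried from one stream item to the next (computation between items is not restricted), and at the end it outputs, from its memory, a matching as a set of weighted edges. Edge weights come from a fixed finite set $\Omega_n$ of positive reals (the numbers representable by the machine). An algorithm "uses $p(n,m,W)$ passes and space $s(n,m,W)$" if for all $n,m$ and $W\ge 1$, given these parameters, it uses that many passes and that much space on all graphs with $n$ vertices, at most $m$ edges and aspect ratio at most $W$. It is semi-streaming if its space is $O(n\,\mathrm{polylog}\, n)$ whenever $W\le \mathrm{poly}(n)$ and $m \le \binom n2$ (constants may depend on the approximation parameter $\varepsilon$ and on the exponent of the polynomial). **Theorem.** There is an absolute constant $C>0$ such that the following holds for every constant $c>0$. There is a function $W_0(\varepsilon)=\Theta(\varepsilon^{-(2+c)})$,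 where the hidden constants depend only on $c$, such that for every $\varepsilon\in(0,1)$: if there is a semi-streaming algorithm for $(1-\varepsilon)$-approximate MWM in general graphs that uses $p(n,m,W,\varepsilon)$ passes and $s(n,m,W,\varepsilon)$ space, then there is a semi-streaming algorithm for $\bigl(1-C(1+\tfrac1c)\varepsilon\bigr)$-approximate MWM in general graphs that, on graphs with aspect ratio at most $W$, uses $p(n,m,W_0(\varepsilon),\varepsilon)$ passes and $$O\bigl(s(n,m,W_0(\varepsilon),\varepsilon)\cdot(1+\log_{1/\varepsilon}W)\bigr)$$ space, where the constant in $O(\cdot)$ depends only on $c$. -/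

import Mathlib

/-- `M` is a matching of `G`: a finite set of pairwise vertex-disjoint edges of `G`. -/
def IsEdgeMatching {V : Type*} (G : SimpleGraph V) (M : Finset (Sym2 V)) : Prop :=
  (∀ e ∈ M, e ∈ G.edgeSet) ∧ ∀ e ∈ M, ∀ f ∈ M, ∀ v : V, v ∈ e → v ∈ f → e = f

/-- `M` is an `α`-approximate maximum weight matching of `(G, w)`. -/
def IsApproxMWM {V : Type*} (G : SimpleGraph V) (w : Sym2 V → ℝ) (α : ℝ)
    (M : Finset (Sym2 V)) : Prop :=
  IsEdgeMatching G M ∧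
    ∀ M' : Finset (Sym2 V), IsEdgeMatching G M' → α * ∑ e ∈ M', w e ≤ ∑ e ∈ M, w e

/-- `(G, w)` has aspect ratio (largest over smallest edge weight) at most `W`. -/
def AspectRatioLE {V : Type*} (G : SimpleGraph V) (w : Sym2 V → ℝ) (W : ℝ) : Prop :=
  ∀ e ∈ G.edgeSet, ∀ f ∈ G.edgeSet, w e ≤ W * w f

/-- `l` lists every edge of `G` exactly once. -/
def IsEdgeOrdering {V : Type*} (G : SimpleGraph V) (l : List (Sym2 V)) : Prop :=
  l.Nodup ∧ ∀ e : Sym2 V, e ∈ l ↔ e ∈ G.edgeSet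

/-- The contents of a memory of `s` bits. -/
abbrev Memory (s : ℕ) : Type := Fin s → Bool

/-- A deterministic streaming algorithm on the vertex set `Fin n` with `s` bits of memory.
The items of the stream are weighted edges. The memory is all that is carried from one
item to the next and from one pass to the next, and the output (a set of weighted edges)
is computed from the final memory. As usual in the streaming model, the computation
between two items is not restricted. -/
structure StreamingAlgorithm (n s : ℕ) where
  init : Memory s
  step : Memory s → Sym2 (Fin n) × ℝ → Memory s
  endPass : Memory s → Memory s
  output : Memory s → Finset (Sym2 (Fin n) × ℝ)

namespace StreamingAlgorithm

/-- One pass over the stream `x`, started with memory `σ`. -/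
def pass {n s : ℕ} (A : StreamingAlgorithm n s) (x : List (Sym2 (Fin n) × ℝ))
    (σ : Memory s) : Memory s :=
  A.endPass (x.foldl A.step σ)

/-- The output after `p` passes over the stream `x`. -/
def run {n s : ℕ} (A : StreamingAlgorithm n s) (p : ℕ)
    (x : List (Sym2 (Fin n) × ℝ)) : Finset (Sym2 (Fin n) × ℝ) :=
  A.output ((A.pass x)^[p] A.init)

/-- With `p` passes, `A` outputs an `α`-approximate maximum weight matching (as a set of
weighted edges) of every graph on `Fin n` with at most `m` edges, weights in `Ω` and aspect
ratio at most `W`, whatever the order of the edges in the stream. -/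
def SolvesMWM {n s : ℕ} (A : StreamingAlgorithm n s) (p m : ℕ) (Ω : Finset ℝ)
    (W α : ℝ) : Prop :=
  ∀ (G : SimpleGraph (Fin n)) (w : Sym2 (Fin n) → ℝ) (l : List (Sym2 (Fin n))),
    IsEdgeOrdering G l → l.length ≤ m → (∀ e ∈ G.edgeSet, w e ∈ Ω) → AspectRatioLE G w W →
    ∃ M : Finset (Sym2 (Fin n)), IsApproxMWM G w α M ∧
      (A.run p (l.map fun e => (e, w e)) : Set (Sym2 (Fin n) × ℝ)) =
        (fun e => (e, w e)) '' (M : Set (Sym2 (Fin n)))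

end StreamingAlgorithm

/-- The space bound `s n m W` is `O(n polylog n)` on graphs with `n` vertices and `m` edges
whose aspect ratio `W` is polynomially bounded in `n`. -/
def IsSemiStreamingSpace (s : ℕ → ℕ → ℝ → ℕ) : Prop :=
  ∀ d : ℕ, ∃ (C : ℝ) (k : ℕ), ∀ (n m : ℕ) (W : ℝ),
    2 ≤ n → m ≤ n.choose 2 → 1 ≤ W → W ≤ (n : ℝ) ^ d →
      (s n m W : ℝ) ≤ C * (n * Real.log n ^ k)

/-- There is a semi-streaming algorithm for `α`-approximate maximum weight matching which,
on graphs with `n` vertices, at most `m` edges, weights in `Ω n` and aspect ratio at most `W`,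
uses `p n m W` passes and `s n m W` bits of memory. -/
def HasSemiStreamingMWM (Ω : ℕ → Finset ℝ) (α : ℝ) (p s : ℕ → ℕ → ℝ → ℕ) : Prop :=
  IsSemiStreamingSpace s ∧
    ∀ (n m : ℕ) (W : ℝ), 1 ≤ W →
      ∃ A : StreamingAlgorithm n (s n m W), A.SolvesMWM (p n m W) m (Ω n) W α

/-! Put q = ε^(-c) and cut the weights into classes [ℓqⁱ, ℓqⁱ⁺¹). Widening each class by a factor
1/ε on both sides gives windows of aspect ratio q/ε² = ε^(-(2+c)) = W₀. The given algorithm runs on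
all windows in parallel, and the output is the best matching in the union of the window matchings
Hᵢ. The number of passes is unchanged, and O(1 + log_{1/ε} W) copies suffice for fixed c.

The union contains a good matching (`exists_matching_composition`): starting from an optimal N, the
classes are processed from the heaviest down, each time replacing the edges of N in class i by edges
of Hᵢ (`IsEdgeMatching.exists_exchange`). The union N ∪ Hᵢ has maximum degree two, so a set of edges
can be closed up along its paths and cycles at the price of two boundary edges per initial edge
(`exists_closure_with_small_boundary`). Boundary edges that shield N above the window are lighter
than the shielded edges by a factor ε; those cut off below the window are lighter than the class by
a factor ε. In between, N and Hᵢ are swapped, which is cheap because Hᵢ is nearly optimal in its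
window. All losses are charged to one fixed optimal matching (`IsApproxMWM.sum_le_of_monotone`) and
sum over the classes to O((1 + 1/c)ε).

The windows are placed relative to the first weight of the stream, which must be stored. This fits
in s bits, since a correct algorithm already has to distinguish all one-edge graphs
(`StreamingAlgorithm.SolvesMWM.card_add_one_le`). -/

open Finset

/-! ### Closures with small boundary in graphs of maximum degree two -/

/-- The incidences `(v, g)` of edges `g ∈ E \ A` at vertices `v` covered by `A`. -/
noncomputable def boundaryIncidences {V : Type*} (E A : Finset (Sym2 V)) : Set (V × Sym2 V) :=
  {x | x.2 ∈ E ∧ x.2 ∉ A ∧ x.1 ∈ x.2 ∧ ∃ a ∈ A, x.1 ∈ a}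

/-- Inserting an edge `s(u, v)` adds at most the other incidences at `u` and at `v`. -/
theorem boundaryIncidences_insert_subset {V : Type*} [DecidableEq V] (E A : Finset (Sym2 V))
    (u v : V) :
    boundaryIncidences E (insert s(u, v) A) ⊆
      (boundaryIncidences E A ∪ {x | x.1 = v ∧ x.2 ∈ E ∧ x.2 ≠ s(u, v) ∧ v ∈ x.2}) ∪
        {x | x.1 = u ∧ x.2 ∈ E ∧ x.2 ≠ s(u, v) ∧ u ∈ x.2} := by
  rintro ⟨y, g⟩ ⟨hE, hA, hy, a, ha, hya⟩
  simp only [mem_insert, not_or] at hA ha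
  rcases ha with rfl | ha
  · rcases Sym2.mem_iff.1 hya with rfl | rfl
    · exact Or.inr ⟨rfl, hE, hA.1, hy⟩
    · exact Or.inl (Or.inr ⟨rfl, hE, hA.1, hy⟩)
  · exact Or.inl (Or.inl ⟨hE, hA.2, hy, a, ha, hya⟩)

theorem finite_boundaryIncidences {V : Type*} [DecidableEq V] (E A : Finset (Sym2 V)) :
    (boundaryIncidences E A).Finite := by
  classical
  refine Set.Finite.subset (E.biUnion fun g => g.toFinset ×ˢ {g}).finite_toSet ?_
  rintro ⟨y, g⟩ ⟨hE, -, hy, -⟩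
  simp only [coe_biUnion, Set.mem_iUnion, mem_coe]
  exact ⟨g, hE, by simpa using hy⟩

theorem finite_incidences {V : Type*} (E : Finset (Sym2 V)) (e : Sym2 V) (v : V) :
    {x : V × Sym2 V | x.1 = v ∧ x.2 ∈ E ∧ x.2 ≠ e ∧ v ∈ x.2}.Finite :=
  Set.Finite.subset (({v} : Set V).toFinite.prod E.finite_toSet) fun _ h => ⟨h.1, h.2.1⟩

/-- At most two edges of `E` meet at each vertex. -/
def DegreeLETwo {V : Type*} (E : Finset (Sym2 V)) : Prop :=
  ∀ v : V, ∀ e ∈ E, ∀ f ∈ E, ∀ g ∈ E, v ∈ e → v ∈ f → v ∈ g → e = f ∨ e = g ∨ f = g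

theorem ncard_other_incidences_le_one {V : Type*} {E : Finset (Sym2 V)}
    (hE : DegreeLETwo E) (v : V) {e : Sym2 V} (he : e ∈ E) (hv : v ∈ e) :
    {x : V × Sym2 V | x.1 = v ∧ x.2 ∈ E ∧ x.2 ≠ e ∧ v ∈ x.2}.ncard ≤ 1 := by
  have := (finite_incidences E e v).to_subtype
  rw [Set.ncard_le_one_iff_subsingleton]
  rintro ⟨y, g⟩ ⟨h1, h2, h3, h4⟩ ⟨y', g'⟩ ⟨h1', h2', h3', h4'⟩
  simp only at *
  subst h1 h1'
  rcases hE _ e he g h2 g' h2' hv h4 h4' with h | h | h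
  · exact absurd h.symm h3
  · exact absurd h.symm h3'
  · rw [h]

theorem ncard_boundaryIncidences_insert_le {V : Type*} [DecidableEq V] {E A : Finset (Sym2 V)}
    (hE : DegreeLETwo E) {e : Sym2 V} (he : e ∈ E) :
    (boundaryIncidences E (insert e A)).ncard ≤ (boundaryIncidences E A).ncard + 2 := by
  induction e with | _ u v
  have h1 := ncard_other_incidences_le_one hE v he (by simp)
  have h2 := ncard_other_incidences_le_one hE u he (by simp)
  have hf := finite_incidences E s(u, v)
  have := Set.ncard_le_ncard (boundaryIncidences_insert_subset E A u v)
    (((finite_boundaryIncidences E A).union (hf v)).union (hf u))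
  have h3 := Set.ncard_union_le (boundaryIncidences E A ∪
    {x | x.1 = v ∧ x.2 ∈ E ∧ x.2 ≠ s(u, v) ∧ v ∈ x.2})
    {x | x.1 = u ∧ x.2 ∈ E ∧ x.2 ≠ s(u, v) ∧ u ∈ x.2}
  have h4 := Set.ncard_union_le (boundaryIncidences E A)
    {x | x.1 = v ∧ x.2 ∈ E ∧ x.2 ≠ s(u, v) ∧ v ∈ x.2}
  omega

/-- The incidence `(u, e)` leaves the boundary, and only the one further edge at the other endpoint
of `e` can enter it. -/
theorem ncard_boundaryIncidences_insert_le_of_adj {V : Type*} [DecidableEq V]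
    {E A : Finset (Sym2 V)} (hE : DegreeLETwo E) {e : Sym2 V} (he : e ∈ E) (heA : e ∉ A)
    {u : V} (hu : u ∈ e) {a : Sym2 V} (ha : a ∈ A) (hua : u ∈ a) :
    (boundaryIncidences E (insert e A)).ncard ≤ (boundaryIncidences E A).ncard := by
  obtain ⟨v, rfl⟩ := hu
  have h1 := ncard_other_incidences_le_one hE v he (by simp)
  have hf := finite_incidences E s(u, v) v
  have hmem : (u, s(u, v)) ∈ boundaryIncidences E A := ⟨he, heA, by simp, a, ha, hua⟩
  have hsub : boundaryIncidences E (insert s(u, v) A) ⊆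
      (boundaryIncidences E A \ {(u, s(u, v))}) ∪
        {x | x.1 = v ∧ x.2 ∈ E ∧ x.2 ≠ s(u, v) ∧ v ∈ x.2} := by
    intro x hx
    have hne : x ≠ (u, s(u, v)) := by
      rintro rfl
      exact hx.2.1 (mem_insert_self _ _)
    rcases boundaryIncidences_insert_subset E A u v hx with (h | h) | h
    · exact Or.inl ⟨h, hne⟩
    · exact Or.inr h
    · obtain ⟨rfl, h2, h3, h4⟩ := h
      exact Or.inl ⟨⟨h2, fun h => hx.2.1 (mem_insert_of_mem h), h4, a, ha, hua⟩, hne⟩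
  have h2 := Set.ncard_le_ncard hsub (((finite_boundaryIncidences E A).sdiff).union hf)
  have h3 := Set.ncard_union_le (boundaryIncidences E A \ {(u, s(u, v))})
    {x | x.1 = v ∧ x.2 ∈ E ∧ x.2 ≠ s(u, v) ∧ v ∈ x.2}
  have h4 := Set.ncard_sdiff_singleton_add_one hmem (finite_boundaryIncidences E A)
  omega

theorem ncard_boundaryIncidences_le {V : Type*} [DecidableEq V] {E B : Finset (Sym2 V)}
    (hE : DegreeLETwo E) (hB : B ⊆ E) : (boundaryIncidences E B).ncard ≤ 2 * #B := by
  induction B using Finset.induction_on with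
  | empty => simp [boundaryIncidences]
  | insert e B heB ih =>
    have h1 := ncard_boundaryIncidences_insert_le (A := B) hE (hB (mem_insert_self _ _))
    have h2 := ih ((subset_insert _ _).trans hB)
    rw [card_insert_of_notMem heB]
    omega

/-- In a graph of maximum degree two, the set `B` of edges can be enlarged by edges of `P` so
that no further edge of `P` is adjacent, with at most `2 * #B` edges on the boundary. -/
theorem exists_closure_with_small_boundary {V : Type*} [DecidableEq V] {E B P : Finset (Sym2 V)}
    (hE : DegreeLETwo E) (hB : B ⊆ E) :
    ∃ A F : Finset (Sym2 V), B ⊆ A ∧ A ⊆ B ∪ P ∧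
      (∀ g, g ∈ F ↔ g ∈ E ∧ g ∉ A ∧ ∃ v ∈ g, ∃ a ∈ A, v ∈ a) ∧
      (∀ g ∈ F, g ∉ P) ∧ #F ≤ 2 * #B := by
  classical
  -- A largest set within the boundary bound is closed under adjacency in `P`: adding an adjacent
  -- edge would not increase the boundary.
  obtain ⟨A, hA, hmax⟩ := ((B ∪ P).powerset.filter
    (fun A => B ⊆ A ∧ (boundaryIncidences E A).ncard ≤ 2 * #B)).exists_max_image (fun A => #A)
    ⟨B, mem_filter.2 ⟨mem_powerset.2 subset_union_left, Subset.rfl,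
      ncard_boundaryIncidences_le hE hB⟩⟩
  simp only [mem_filter, mem_powerset] at hA hmax
  obtain ⟨hAP, hBA, hcard⟩ := hA
  refine ⟨A, E.filter fun g => g ∉ A ∧ ∃ v ∈ g, ∃ a ∈ A, v ∈ a, hBA, hAP, by simp, ?_, ?_⟩
  · intro g hg hgP
    simp only [mem_filter] at hg
    obtain ⟨hgE, hgA, v, hv, a, ha, hva⟩ := hg
    have := hmax (insert g A) ⟨insert_subset (mem_union_right _ hgP) hAP,
      hBA.trans (subset_insert _ _),
      (ncard_boundaryIncidences_insert_le_of_adj hE hgE hgA hv ha hva).trans hcard⟩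
    rw [card_insert_of_notMem hgA] at this
    omega
  · refine le_trans ?_ hcard
    rw [← Set.ncard_coe_finset]
    have hsub : ((E.filter fun g => g ∉ A ∧ ∃ v ∈ g, ∃ a ∈ A, v ∈ a : Finset (Sym2 V)) :
        Set (Sym2 V)) ⊆ Prod.snd '' boundaryIncidences E A := by
      intro g hg
      simp only [coe_filter, Set.mem_ofPred_eq] at hg
      obtain ⟨hgE, hgA, v, hv, a, ha, hva⟩ := hg
      exact ⟨(v, g), ⟨hgE, hgA, hv, a, ha, hva⟩, rfl⟩
    exact (Set.ncard_le_ncard hsub ((finite_boundaryIncidences E A).image _)).trans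
      (Set.ncard_image_le (finite_boundaryIncidences E A))

/-! ### Exchanging one weight class -/

theorem IsEdgeMatching.degreeLETwo_union {V : Type*} [DecidableEq V] {G : SimpleGraph V}
    {M N : Finset (Sym2 V)} (hM : IsEdgeMatching G M) (hN : IsEdgeMatching G N) :
    DegreeLETwo (M ∪ N) := by
  intro v e he f hf g hg hve hvf hvg
  have hm := fun a ha b hb => hM.2 a ha b hb v
  have hn := fun a ha b hb => hN.2 a ha b hb v
  simp only [mem_union] at he hf hg
  grind

theorem card_le_sum_ite {α : Type*} (s : Finset α) (p : α → Prop) [DecidablePred p] (x : ℝ) :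
    x * #(s.filter p) = ∑ e ∈ s, if p e then x else 0 := by
  rw [← sum_filter, sum_const, nsmul_eq_mul, mul_comm]

/-- Exchange step. `H` is an approximate maximum weight matching among the edges with weight in
`[a, b)`. In the matching `N`, the edges with weight in `[l, r)` can be replaced by edges of `H`
at a small cost, leaving all heavier edges in `N` or `H`. -/
theorem IsEdgeMatching.exists_exchange {V : Type*} [DecidableEq V] {G : SimpleGraph V}
    {w : Sym2 V → ℝ} {N H : Finset (Sym2 V)} {a l r b ε : ℝ}
    (hN : IsEdgeMatching G N) (hH : IsEdgeMatching G H) (ha : 0 ≤ a) (hal : a ≤ l)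
    (hlr : l ≤ r) (hrb : r ≤ b) (hHw : ∀ e ∈ H, a ≤ w e ∧ w e < b)
    (hopt : ∀ H' : Finset (Sym2 V), IsEdgeMatching G H' → (∀ e ∈ H', a ≤ w e ∧ w e < b) →
      (1 - ε) * ∑ e ∈ H', w e ≤ ∑ e ∈ H, w e) :
    ∃ N' H' : Finset (Sym2 V), IsEdgeMatching G N' ∧ IsEdgeMatching G H' ∧
      (∀ e ∈ H', a ≤ w e ∧ w e < b) ∧
      (∀ e ∈ N', l ≤ w e → e ∈ H ∨ (e ∈ N ∧ r ≤ w e)) ∧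
      ∑ e ∈ N, w e - (4 * ∑ e ∈ N, (if b ≤ w e then r else 0) +
        2 * ∑ e ∈ N, (if l ≤ w e then a else 0) + ε * ∑ e ∈ H', w e) ≤ ∑ e ∈ N', w e := by
  classical
  have hE := hN.degreeLETwo_union hH
  -- `A` shields the edges of `N` above the window. Deleting its boundary `F`, whose edges weigh
  -- less than `r`, isolates it.
  obtain ⟨A, F, hBA, hAP, hF, hFP, hFcard⟩ := exists_closure_with_small_boundary
    (E := N ∪ H) (B := N.filter fun e => b ≤ w e) (P := (N ∪ H).filter fun e => r ≤ w e) hE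
    ((filter_subset _ _).trans subset_union_left)
  have hAr : ∀ e ∈ A, r ≤ w e := by
    intro e he
    have := hAP he
    simp only [mem_union, mem_filter] at this
    rcases this with h | h
    · exact hrb.trans h.2
    · exact h.2
  have hFr : ∀ e ∈ F, w e ≤ r := by
    intro e he
    by_contra! h
    exact hFP e he (by simp only [mem_filter]; exact ⟨((hF e).1 he).1, h.le⟩)
  -- `R` is the region of the swap, grown from the class edges of `N`. Its boundary edges outside
  -- `F` weigh less than `a`: a heavier one would lie in `A`, putting its neighbour in `R` into `F`.
  obtain ⟨R, L, hBR, hRP, hL, hLP, hLcard⟩ := exists_closure_with_small_boundary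
    (E := N ∪ H) (B := N.filter fun e => l ≤ w e ∧ w e < r ∧ e ∉ F)
    (P := (N ∪ H).filter fun e => a ≤ w e ∧ e ∉ A ∧ e ∉ F) hE
    ((filter_subset _ _).trans subset_union_left)
  have hR : ∀ e ∈ R, e ∈ N ∪ H ∧ a ≤ w e ∧ e ∉ A ∧ e ∉ F := by
    intro e he
    have := hRP he
    simp only [mem_union, mem_filter] at this ⊢
    rcases this with h | h
    · exact ⟨Or.inl h.1, hal.trans h.2.1, fun h' => absurd (hAr e h') (not_le.2 h.2.2.1), h.2.2.2⟩
    · exact h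
  have hLlow : ∀ e ∈ L, e ∉ F → w e < a := by
    intro e he heF
    by_contra! h
    obtain ⟨h1, h2, v, hv, g, hg, hvg⟩ := (hL e).1 he
    refine hLP e he (by
      simp only [mem_filter]
      refine ⟨h1, h, fun heA => ?_, heF⟩
      exact (hR g hg).2.2.2 ((hF g).2 ⟨(hR g hg).1, (hR g hg).2.2.1, v, hvg, e, heA, hv⟩))
  have hadj : ∀ e ∈ N ∪ H, e ∉ R → ∀ g ∈ R, ∀ v, v ∈ e → v ∈ g → e ∈ F ∨ (e ∈ L ∧ w e < a) := by
    intro e he heR g hg v hve hvg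
    by_cases heF : e ∈ F
    · exact Or.inl heF
    · have := (hL e).2 ⟨he, heR, v, hve, g, hg, hvg⟩
      exact Or.inr ⟨this, hLlow e this heF⟩
  have hNm := hN.2
  have hHm := hH.2
  have hNG := hN.1
  have hHG := hH.1
  -- The mirror image of the swap is a matching inside the window, so near-optimality of `H` bounds
  -- the weight of `N ∩ R` by that of `H ∩ R`, up to the edges of `F` and the `ε` term.
  have hH'm : IsEdgeMatching G ((H \ (F ∪ R)) ∪ (N ∩ R)) := by
    refine ⟨fun e he => ?_, fun e he f hf v hve hvf => ?_⟩
    · simp only [mem_union, mem_sdiff, mem_inter] at he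
      grind
    · simp only [mem_union, mem_sdiff, mem_inter, not_or] at he hf
      rcases he with he | he <;> rcases hf with hf | hf
      · exact hHm e he.1 f hf.1 v hve hvf
      · rcases hadj e (mem_union_right _ he.1) he.2.2 f hf.2 v hve hvf with h | h
        · exact absurd h he.2.1
        · exact absurd (hHw e he.1).1 (not_le.2 h.2)
      · rcases hadj f (mem_union_right _ hf.1) hf.2.2 e he.2 v hvf hve with h | h
        · exact absurd h hf.2.1
        · exact absurd (hHw f hf.1).1 (not_le.2 h.2)
      · exact hNm e he.1 f hf.1 v hve hvf
  have hH'w : ∀ e ∈ (H \ (F ∪ R)) ∪ (N ∩ R), a ≤ w e ∧ w e < b := by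
    intro e he
    simp only [mem_union, mem_sdiff, mem_inter] at he
    rcases he with he | he
    · exact hHw e he.1
    · refine ⟨(hR e he.2).2.1, ?_⟩
      by_contra! h
      exact (hR e he.2).2.2.1 (hBA (by simp [he.1, h]))
  have hL' : ∀ e ∈ L \ F, w e < a := fun e he => hLlow e (mem_sdiff.1 he).1 (mem_sdiff.1 he).2
  refine ⟨(N \ (F ∪ R ∪ (L \ F))) ∪ (H ∩ R), (H \ (F ∪ R)) ∪ (N ∩ R), ?_, hH'm, hH'w, ?_, ?_⟩
  · refine ⟨fun e he => ?_, fun e he f hf v hve hvf => ?_⟩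
    · simp only [mem_union, mem_sdiff, mem_inter] at he
      grind
    · simp only [mem_union, mem_sdiff, mem_inter, not_or, not_and, not_not] at he hf
      rcases he with he | he <;> rcases hf with hf | hf
      · exact hNm e he.1 f hf.1 v hve hvf
      · rcases hadj e (mem_union_left _ he.1) he.2.1.2 f hf.2 v hve hvf with h | h
        · exact absurd h he.2.1.1
        · exact absurd (he.2.2 h.1) he.2.1.1
      · rcases hadj f (mem_union_left _ hf.1) hf.2.1.2 e he.2 v hvf hve with h | h
        · exact absurd h hf.2.1.1
        · exact absurd (hf.2.2 h.1) hf.2.1.1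
      · exact hHm e he.1 f hf.1 v hve hvf
  · intro e he hle
    simp only [mem_union, mem_sdiff, mem_inter, not_or] at he
    rcases he with he | he
    · refine Or.inr ⟨he.1, ?_⟩
      by_contra! h
      exact he.2.1.2 (hBR (by simp [he.1, h, hle, he.2.1.1]))
    · exact Or.inl he.1
  · have hopt' := hopt _ hH'm hH'w
    have hFR : Disjoint F R := disjoint_left.2 fun e he heR => (hR e heR).2.2.2 he
    have hRL : Disjoint (F ∪ R) (L \ F) := disjoint_left.2 fun e he heL => by
      simp only [mem_union, mem_sdiff] at he heL
      rcases he with h | h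
      · exact heL.2 h
      · exact ((hL e).1 heL.1).2.1 h
    have e1 : ∑ e ∈ (H \ (F ∪ R)) ∪ (N ∩ R), w e =
        ∑ e ∈ H, w e - ∑ e ∈ H ∩ F, w e - ∑ e ∈ H ∩ R, w e + ∑ e ∈ N ∩ R, w e := by
      rw [sum_union (disjoint_left.2 fun e he he' => by
        simp only [mem_union, mem_sdiff, mem_inter, not_or] at he he'
        exact he.2.2 he'.2)]
      have := sum_inter_add_sum_sdiff H (F ∪ R) w
      rw [inter_union_distrib_left, sum_union (hFR.mono inter_subset_right inter_subset_right)]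
        at this
      linarith
    have e2 : ∑ e ∈ (N \ (F ∪ R ∪ (L \ F))) ∪ (H ∩ R), w e =
        ∑ e ∈ N, w e - ∑ e ∈ N ∩ F, w e - ∑ e ∈ N ∩ R, w e - ∑ e ∈ N ∩ (L \ F), w e
          + ∑ e ∈ H ∩ R, w e := by
      rw [sum_union (disjoint_left.2 fun e he he' => by
        simp only [mem_union, mem_sdiff, mem_inter, not_or] at he he'
        exact he.2.1.2 he'.2)]
      have := sum_inter_add_sum_sdiff N (F ∪ R ∪ (L \ F)) w
      rw [inter_union_distrib_left, sum_union (hRL.mono inter_subset_right inter_subset_right),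
        inter_union_distrib_left, sum_union (hFR.mono inter_subset_right inter_subset_right)]
        at this
      linarith
    have hr : 0 ≤ r := ha.trans (hal.trans hlr)
    have hFsum (X : Finset (Sym2 V)) : ∑ e ∈ X ∩ F, w e ≤ r * #F := by
      calc ∑ e ∈ X ∩ F, w e ≤ #(X ∩ F) • r :=
            sum_le_card_nsmul _ _ _ fun e he => hFr e (mem_inter.1 he).2
        _ = r * #(X ∩ F) := by rw [nsmul_eq_mul, mul_comm]
        _ ≤ r * #F := by gcongr; exact inter_subset_right
    have hLsum : ∑ e ∈ N ∩ (L \ F), w e ≤ a * #L := by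
      calc ∑ e ∈ N ∩ (L \ F), w e ≤ #(N ∩ (L \ F)) • a :=
            sum_le_card_nsmul _ _ _ fun e he => (hL' e (mem_inter.1 he).2).le
        _ = a * #(N ∩ (L \ F)) := by rw [nsmul_eq_mul, mul_comm]
        _ ≤ a * #L := by gcongr; exact inter_subset_right.trans sdiff_subset
    have hF2 : r * #F ≤ 2 * ∑ e ∈ N, (if b ≤ w e then r else 0) := by
      rw [← card_le_sum_ite]
      calc r * #F ≤ r * (2 * #(N.filter fun e => b ≤ w e) : ℕ) := by gcongr
        _ = _ := by push_cast; ring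
    have hL2 : a * #L ≤ 2 * ∑ e ∈ N, (if l ≤ w e then a else 0) := by
      rw [← card_le_sum_ite]
      calc a * #L ≤ a * (2 * #(N.filter fun e => l ≤ w e ∧ w e < r ∧ e ∉ F) : ℕ) := by gcongr
        _ ≤ a * (2 * #(N.filter fun e => l ≤ w e) : ℕ) := by
          gcongr
          grind
        _ = _ := by push_cast; ring
    -- `F` is paid for twice, once as edges removed from `N` and once as edges missing from the
    -- competitor of `H`; this turns the factor 2 of the closure into 4.
    have := hFsum N
    have := hFsum H
    rw [e2]
    linarith

/-! ### Charging to a maximum weight matching -/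

theorem IsEdgeMatching.subset {V : Type*} {G : SimpleGraph V} {M N : Finset (Sym2 V)}
    (hM : IsEdgeMatching G M) (h : N ⊆ M) : IsEdgeMatching G N :=
  ⟨fun e he => hM.1 e (h he), fun e he f hf => hM.2 e (h he) f (h hf)⟩

theorem isEdgeMatching_empty {V : Type*} (G : SimpleGraph V) : IsEdgeMatching G ∅ := by
  simp [IsEdgeMatching]

/-- An edge meets at most two edges of a matching. -/
theorem IsEdgeMatching.card_le_two {V : Type*} {G : SimpleGraph V}
    {M : Finset (Sym2 V)} (hM : IsEdgeMatching G M) (e : Sym2 V)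
    (h : ∀ f ∈ M, ∃ v ∈ e, v ∈ f) : #M ≤ 2 := by
  classical
  induction e with | _ u v
  have hsub : M ⊆ M.filter (fun f => u ∈ f) ∪ M.filter (fun f => v ∈ f) := by
    intro f hf
    obtain ⟨z, hz, hzf⟩ := h f hf
    rcases Sym2.mem_iff.1 hz with rfl | rfl
    · exact mem_union_left _ (mem_filter.2 ⟨hf, hzf⟩)
    · exact mem_union_right _ (mem_filter.2 ⟨hf, hzf⟩)
  have h1 (z : V) : #(M.filter fun f => z ∈ f) ≤ 1 := by
    refine card_le_one.2 fun a ha b hb => ?_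
    simp only [mem_filter] at ha hb
    exact hM.2 a ha.1 b hb.1 z ha.2 hb.2
  calc #M ≤ _ := card_le_card hsub
    _ ≤ _ := card_union_le _ _
    _ ≤ 2 := by linarith [h1 u, h1 v]

theorem exists_max_edgeMatching {V : Type*} [Fintype V] (G : SimpleGraph V) (w : Sym2 V → ℝ) :
    ∃ M : Finset (Sym2 V), IsApproxMWM G w 1 M := by
  classical
  obtain ⟨M, hM, hmax⟩ := ((univ : Finset (Finset (Sym2 V))).filter
    (IsEdgeMatching G)).exists_max_image (fun M => ∑ e ∈ M, w e)
    ⟨∅, by simp [isEdgeMatching_empty]⟩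
  simp only [mem_filter, mem_univ, true_and] at hM hmax
  exact ⟨M, hM, fun M' hM' => by simpa using hmax M' hM'⟩

/-- Every edge meets an edge of a maximum weight matching with at least half its weight. -/
theorem IsApproxMWM.exists_dominating {V : Type*} {G : SimpleGraph V} {w : Sym2 V → ℝ}
    {M : Finset (Sym2 V)} (hM : IsApproxMWM G w 1 M) (hw : ∀ e ∈ G.edgeSet, 0 < w e)
    {e : Sym2 V} (he : e ∈ G.edgeSet) : ∃ m ∈ M, (∃ v ∈ m, v ∈ e) ∧ w e ≤ 2 * w m := by
  classical
  by_contra! hcon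
  set S := M.filter fun m => ∃ v ∈ m, v ∈ e with hS
  have hSM : S ⊆ M := filter_subset _ _
  have heM : e ∉ M := by
    intro heM
    have hve : ∃ v, v ∈ e := by
      induction e with | _ u v => exact ⟨u, by simp⟩
    obtain ⟨v, hv⟩ := hve
    have := hcon e heM ⟨v, hv, hv⟩
    linarith [hw e he]
  have hmatch : IsEdgeMatching G (insert e (M \ S)) := by
    have hd : ∀ f ∈ M \ S, ∀ v, v ∈ e → v ∉ f := by
      intro f hf v hve hvf
      simp only [hS, mem_sdiff, mem_filter, not_and] at hf
      exact hf.2 hf.1 ⟨v, hvf, hve⟩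
    refine ⟨fun f hf => ?_, fun f hf g hg v hvf hvg => ?_⟩
    · rcases mem_insert.1 hf with rfl | hf
      · exact he
      · exact hM.1.1 f (mem_sdiff.1 hf).1
    · rcases mem_insert.1 hf with rfl | hf <;> rcases mem_insert.1 hg with rfl | hg
      · rfl
      · exact absurd hvg (hd g hg v hvf)
      · exact absurd hvf (hd f hf v hvg)
      · exact hM.1.2 f (mem_sdiff.1 hf).1 g (mem_sdiff.1 hg).1 v hvf hvg
  have hopt := hM.2 _ hmatch
  rw [sum_insert (fun h => heM (mem_sdiff.1 h).1), one_mul] at hopt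
  have hsplit := sum_sdiff (f := w) hSM
  have hcard : #S ≤ 2 := (hM.1.subset hSM).card_le_two e fun f hf => by
    obtain ⟨v, hv, hve⟩ := (mem_filter.1 hf).2
    exact ⟨v, hve, hv⟩
  have hlt : ∀ m ∈ S, w m < w e / 2 := by
    intro m hm
    obtain ⟨hm, v, hv, hve⟩ := mem_filter.1 hm
    linarith [hcon m hm ⟨v, hv, hve⟩]
  have hpos := hw e he
  rcases S.eq_empty_or_nonempty with h0 | h0
  · rw [h0, sum_empty, add_zero] at hsplit
    rw [h0] at hopt
    linarith
  · have h1 := sum_lt_sum_of_nonempty h0 hlt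
    rw [sum_const, nsmul_eq_mul] at h1
    have : (#S : ℝ) ≤ 2 := by exact_mod_cast hcard
    nlinarith

/-- Send each edge of `X` to an adjacent edge of `M` of at least half its weight. This map is at
most two-to-one because `X` is a matching. -/
theorem IsApproxMWM.sum_le_of_monotone {V : Type*} {G : SimpleGraph V} {w : Sym2 V → ℝ}
    {M X : Finset (Sym2 V)} (hM : IsApproxMWM G w 1 M) (hw : ∀ e ∈ G.edgeSet, 0 < w e)
    (hX : IsEdgeMatching G X) {φ : ℝ → ℝ} (hφ : Monotone φ) (hφ0 : ∀ x, 0 ≤ φ x) :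
    ∑ e ∈ X, φ (w e) ≤ 2 * ∑ m ∈ M, φ (2 * w m) := by
  classical
  choose! g hgM hg hgw using fun e he => hM.exists_dominating hw (e := e) he
  rw [← sum_fiberwise_of_maps_to (t := M) (g := g) (fun e he => hgM e (hX.1 e he)), mul_sum]
  refine sum_le_sum fun m hm => ?_
  calc ∑ e ∈ X with g e = m, φ (w e) ≤ #(X.filter fun e => g e = m) • φ (2 * w m) := by
        refine sum_le_card_nsmul _ _ _ fun e he => hφ ?_
        obtain ⟨heX, rfl⟩ := mem_filter.1 he
        exact hgw e (hX.1 e heX)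
    _ ≤ 2 * φ (2 * w m) := by
        rw [nsmul_eq_mul]
        gcongr
        · exact hφ0 _
        · exact_mod_cast (hX.subset (filter_subset _ _)).card_le_two m fun e he => by
            obtain ⟨heX, rfl⟩ := mem_filter.1 he
            exact hg e (hX.1 e heX)

/-! ### Sums over geometric weight classes -/

theorem sum_geom_range_le {q c : ℝ} (hc : 0 < c) (hq : 1 + c ≤ q) (k : ℕ) :
    ∑ i ∈ range k, q ^ i ≤ q ^ k / c := by
  induction k with
  | zero => simp; positivity
  | succ k ih =>
    rw [sum_range_succ, pow_succ]
    have : 0 ≤ q ^ k := pow_nonneg (by linarith) k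
    calc _ ≤ q ^ k / c + q ^ k := by gcongr
      _ = q ^ k * (1 + c) / c := by field_simp
      _ ≤ _ := by gcongr

/-- The sum is geometric and dominated by its largest admissible term, which is at most `y`. -/
theorem sum_geom_of_le {q c a y : ℝ} (hc : 0 < c) (hq : 1 + c ≤ q) (ha : 0 ≤ a) (hy : 0 ≤ y)
    (k : ℕ) : ∑ i ∈ range k, (if a * q ^ i ≤ y then a * q ^ i else 0) ≤ (1 + 1 / c) * y := by
  have hq0 : 0 ≤ q := by linarith
  induction k with
  | zero => simp; positivity
  | succ k ih =>
    rw [sum_range_succ]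
    split_ifs with h
    · calc _ ≤ ∑ i ∈ range k, a * q ^ i + a * q ^ k := by
            gcongr with i hi
            split_ifs <;> first | rfl | positivity
        _ ≤ a * (q ^ k / c) + a * q ^ k := by
            rw [← mul_sum]
            gcongr
            exact sum_geom_range_le hc hq k
        _ = (1 + 1 / c) * (a * q ^ k) := by field_simp; ring
        _ ≤ _ := by gcongr
    · simpa using ih

/-- A weight lies in few of the windows `[a * q ^ i, b * q ^ i)`. -/
theorem card_windows_le {q a b y D : ℝ} (hq : 1 < q) (ha : 0 < a) (hb : b ≤ a * q ^ D)
    (k : ℕ) : (#((range k).filter fun i => a * q ^ i ≤ y ∧ y < b * q ^ i) : ℝ) ≤ max (D + 1) 0 := by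
  set S := (range k).filter fun i => a * q ^ i ≤ y ∧ y < b * q ^ i with hS
  rcases S.eq_empty_or_nonempty with h0 | h0
  · simp [h0]
  refine le_max_of_le_left ?_
  have hsub : S ⊆ Icc (S.min' h0) (S.max' h0) := fun i hi =>
    mem_Icc.2 ⟨S.min'_le i hi, S.le_max' i hi⟩
  have hcard := card_le_card hsub
  rw [Nat.card_Icc] at hcard
  have hmin := (mem_filter.1 (S.min'_mem h0)).2
  have hmax := (mem_filter.1 (S.max'_mem h0)).2
  have hle := S.min'_le_max' h0
  set i := S.min' h0
  set j := S.max' h0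
  have hq0 : 0 < q := by linarith
  have h1 : a * q ^ j < a * q ^ D * q ^ i :=
    hmax.1.trans_lt (hmin.2.trans_le (by gcongr))
  have h2 : q ^ (j : ℝ) < q ^ (D + i : ℝ) := by
    rw [Real.rpow_add hq0, Real.rpow_natCast, Real.rpow_natCast]
    rw [mul_assoc] at h1
    exact lt_of_mul_lt_mul_left h1 ha.le
  have h3 := (Real.rpow_lt_rpow_left_iff hq).1 h2
  have h4 : (#S : ℝ) + i ≤ j + 1 := by
    have : #S + i ≤ j + 1 := by omega
    exact_mod_cast this
  linarith

/-- Windows entirely below `y` contribute a geometric sum of their upper ends; the at most `D + 1`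
windows containing `y` contribute `y` each. -/
theorem sum_truncation_le {q a b y c D : ℝ} (hc : 0 < c) (hq : 1 + c ≤ q) (ha : 0 < a)
    (hb0 : 0 ≤ b) (hb : b ≤ a * q ^ D) (hD : 0 ≤ D) (hy : 0 ≤ y) (k : ℕ) :
    ∑ i ∈ range k, (if a * q ^ i ≤ y then min y (b * q ^ i) else 0) ≤
      (1 + 1 / c + (D + 1)) * y := by
  have hq0 : 0 ≤ q := by linarith
  calc _ ≤ ∑ i ∈ range k, ((if b * q ^ i ≤ y then b * q ^ i else 0) +
          if a * q ^ i ≤ y ∧ y < b * q ^ i then y else 0) := by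
        refine sum_le_sum fun i _ => ?_
        have : 0 ≤ b * q ^ i := by positivity
        grind
    _ ≤ (1 + 1 / c) * y + (D + 1) * y := by
        rw [sum_add_distrib]
        gcongr
        · exact sum_geom_of_le hc hq hb0 hy k
        · rw [← card_le_sum_ite, mul_comm]
          gcongr
          simpa [hD, add_nonneg] using
            (card_windows_le (y := y) (by linarith) ha hb k).trans_eq (max_eq_left (by linarith))
    _ = _ := by ring

/-! ### Composing the window matchings -/

/-- Matching composition: approximate maximum weight matchings of the windows
`[ε ℓ qⁱ, ℓ qⁱ⁺¹ / ε)` together contain an approximate maximum weight matching. -/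
theorem exists_matching_composition {V : Type*} [DecidableEq V] [Fintype V] {G : SimpleGraph V}
    {w : Sym2 V → ℝ} (hw : ∀ e ∈ G.edgeSet, 0 < w e) {ε ℓ q c D : ℝ} (hε : 0 < ε) (hε1 : ε ≤ 1)
    (hℓ : 0 < ℓ) (hc : 0 < c) (hq : 1 + c ≤ q) (hD : 0 ≤ D) (hqD : q / ε ^ 2 ≤ q ^ D) (k : ℕ)
    (hwk : ∀ e ∈ G.edgeSet, ℓ ≤ w e ∧ w e < ℓ * q ^ k) (H : ℕ → Finset (Sym2 V))
    (hH : ∀ i < k, IsEdgeMatching G (H i))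
    (hHw : ∀ i < k, ∀ e ∈ H i, ε * (ℓ * q ^ i) ≤ w e ∧ w e < ℓ * q ^ (i + 1) / ε)
    (hopt : ∀ i < k, ∀ H' : Finset (Sym2 V), IsEdgeMatching G H' →
      (∀ e ∈ H', ε * (ℓ * q ^ i) ≤ w e ∧ w e < ℓ * q ^ (i + 1) / ε) →
      (1 - ε) * ∑ e ∈ H', w e ≤ ∑ e ∈ H i, w e) :
    ∃ N : Finset (Sym2 V), IsEdgeMatching G N ∧ (∀ e ∈ N, ∃ i < k, e ∈ H i) ∧
      ∀ M, IsApproxMWM G w 1 M →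
        (1 - ε * (28 * (1 + 1 / c) + 4 * (D + 1))) * ∑ e ∈ M, w e ≤ ∑ e ∈ N, w e := by
  obtain ⟨M₀, hM₀⟩ := exists_max_edgeMatching G w
  have hq0 : 0 < q := by linarith
  have hq1 : 1 ≤ q := by linarith
  -- The cost of processing the classes above `j`, charged to the edges of `M₀`.
  let cost : ℕ → ℝ → ℝ := fun i y =>
    4 * (2 * (if ℓ * q ^ (i + 1) / ε ≤ y then ℓ * q ^ (i + 1) else 0)) +
    2 * (2 * (if ℓ * q ^ i ≤ y then ε * (ℓ * q ^ i) else 0)) +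
    ε * (2 * (if ε * (ℓ * q ^ i) ≤ y then min y (ℓ * q ^ (i + 1) / ε) else 0))
  -- After `d` rounds the `d` heaviest classes of `N` consist of edges of the `H i`. The loss is
  -- measured on the fixed `M₀`, since `N` changes in every round.
  have key : ∀ d ≤ k, ∃ N : Finset (Sym2 V), IsEdgeMatching G N ∧
      (∀ e ∈ N, ℓ * q ^ (k - d) ≤ w e → ∃ i < k, e ∈ H i) ∧
      ∑ e ∈ M₀, w e - ∑ i ∈ Ico (k - d) k, ∑ m ∈ M₀, cost i (2 * w m) ≤ ∑ e ∈ N, w e := by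
    intro d
    induction d with
    | zero =>
      intro _
      refine ⟨M₀, hM₀.1, fun e he h => ?_, by simp⟩
      exact absurd (hwk e (hM₀.1.1 e he)).2 (not_lt.2 (by simpa using h))
    | succ d ih =>
      intro hd
      obtain ⟨N, hN, hNd, hNw⟩ := ih (by omega)
      obtain ⟨i, hi⟩ : ∃ i, i = k - (d + 1) := ⟨_, rfl⟩
      have hid : k - d = i + 1 := by omega
      have hik : i < k := by omega
      rw [← hi, ← add_sum_Ioo_eq_sum_Ico hik]
      rw [hid] at hNd hNw
      have hIoo : Ioo i k = Ico (i + 1) k := by ext; simp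
      rw [hIoo]
      have hl : 0 < ℓ * q ^ i := by positivity
      have hlr : ℓ * q ^ i ≤ ℓ * q ^ (i + 1) := by
        gcongr
        omega
      obtain ⟨N', H', hN', hH', hH'w, hN'd, hN'w⟩ := hN.exists_exchange (hH i hik)
        (a := ε * (ℓ * q ^ i)) (l := ℓ * q ^ i) (r := ℓ * q ^ (i + 1))
        (b := ℓ * q ^ (i + 1) / ε) (ε := ε) (by positivity)
        (mul_le_of_le_one_left hl.le hε1) hlr
        (by rw [le_div_iff₀ hε]; exact mul_le_of_le_one_right (by positivity) hε1)
        (hHw i hik) (hopt i hik)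
      refine ⟨N', hN', fun e he h => ?_, ?_⟩
      · rcases hN'd e he h with h | h
        · exact ⟨i, hik, h⟩
        · exact hNd e h.1 h.2
      · have m1 : Monotone fun x : ℝ =>
            if ℓ * q ^ (i + 1) / ε ≤ x then ℓ * q ^ (i + 1) else 0 := by
          intro x y hxy
          have : 0 ≤ ℓ * q ^ (i + 1) := by positivity
          dsimp only
          grind
        have m2 : Monotone fun x : ℝ => if ℓ * q ^ i ≤ x then ε * (ℓ * q ^ i) else 0 := by
          intro x y hxy
          have : 0 ≤ ε * (ℓ * q ^ i) := by positivity
          dsimp only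
          grind
        -- Truncating at the upper end of the window, instead of dropping heavier weights, keeps the
        -- charge monotone; on `H'` it is just the weight.
        have m3 : Monotone fun x : ℝ =>
            if ε * (ℓ * q ^ i) ≤ x then min x (ℓ * q ^ (i + 1) / ε) else 0 := by
          intro x y hxy
          have : 0 ≤ ε * (ℓ * q ^ i) := by positivity
          have : 0 ≤ ℓ * q ^ (i + 1) / ε := by positivity
          dsimp only
          grind
        have h1 := hM₀.sum_le_of_monotone hw hN m1
          (fun x => by split_ifs <;> positivity)
        have h2 := hM₀.sum_le_of_monotone hw hN m2
          (fun x => by split_ifs <;> positivity)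
        have h3 := hM₀.sum_le_of_monotone hw hH' m3
          (fun x => by
            split_ifs with h
            · exact le_min (le_trans (by positivity) h) (by positivity)
            · rfl)
        have h4 : ∑ e ∈ H', (if ε * (ℓ * q ^ i) ≤ w e then min (w e) (ℓ * q ^ (i + 1) / ε)
            else 0) = ∑ e ∈ H', w e := sum_congr rfl fun e he => by
          rw [if_pos (hH'w e he).1, min_eq_left (hH'w e he).2.le]
        rw [h4] at h3
        have h5 : ∑ m ∈ M₀, cost i (2 * w m) =
            4 * (2 * ∑ m ∈ M₀, if ℓ * q ^ (i + 1) / ε ≤ 2 * w m then ℓ * q ^ (i + 1) else 0) +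
            2 * (2 * ∑ m ∈ M₀, if ℓ * q ^ i ≤ 2 * w m then ε * (ℓ * q ^ i) else 0) +
            ε * (2 * ∑ m ∈ M₀, if ε * (ℓ * q ^ i) ≤ 2 * w m then
              min (2 * w m) (ℓ * q ^ (i + 1) / ε) else 0) := by
          simp only [cost, sum_add_distrib, mul_sum]
        have h6 := mul_le_mul_of_nonneg_left h3 hε.le
        linarith
  obtain ⟨N, hN, hNd, hNw⟩ := key k le_rfl
  refine ⟨N, hN, fun e he => hNd e he (by simpa using (hwk e (hN.1 e he)).1), fun M hM => ?_⟩
  have hMM : ∑ e ∈ M, w e ≤ ∑ e ∈ M₀, w e := by simpa using hM₀.2 M hM.1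
  have hMM' : ∑ e ∈ M₀, w e ≤ ∑ e ∈ M, w e := by simpa using hM.2 M₀ hM₀.1
  -- The three kinds of loss contribute 8, 4 and 2 times `ε * (1 + 1 / c)`, the last one also `2 * ε
  -- * (D + 1)`. Evaluating at `2 * w m` then doubles the constants.
  have hcost : ∀ y, 0 ≤ y → ∑ i ∈ range k, cost i y ≤
      ε * (14 * (1 + 1 / c) + 2 * (D + 1)) * y := by
    intro y hy
    have h1 := sum_geom_of_le (y := ε * y) hc hq (mul_pos hℓ hq0).le (by positivity) k
    have h2 := sum_geom_of_le (y := y) hc hq hℓ.le hy k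
    have h3 := sum_truncation_le (a := ε * ℓ) (b := ℓ * q / ε) (D := D) (y := y) hc hq
      (by positivity) (by positivity) (by
        calc ℓ * q / ε = ε * ℓ * (q / ε ^ 2) := by field_simp
          _ ≤ _ := by gcongr) hD hy k
    have e1 : ∑ i ∈ range k, (if ℓ * q ^ (i + 1) / ε ≤ y then ℓ * q ^ (i + 1) else 0) =
        ∑ i ∈ range k, (if ℓ * q * q ^ i ≤ ε * y then ℓ * q * q ^ i else 0) := by
      refine sum_congr rfl fun i _ => ?_
      simp only [pow_succ', ← mul_assoc, div_le_iff₀ hε, mul_comm y]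
    have e2 : ∑ i ∈ range k, (if ℓ * q ^ i ≤ y then ε * (ℓ * q ^ i) else 0) =
        ε * ∑ i ∈ range k, (if ℓ * q ^ i ≤ y then ℓ * q ^ i else 0) := by
      rw [mul_sum]
      exact sum_congr rfl fun i _ => by split_ifs <;> simp
    have e3 : ∑ i ∈ range k, (if ε * (ℓ * q ^ i) ≤ y then min y (ℓ * q ^ (i + 1) / ε) else 0) =
        ∑ i ∈ range k, (if ε * ℓ * q ^ i ≤ y then min y (ℓ * q / ε * q ^ i) else 0) := by
      refine sum_congr rfl fun i _ => ?_
      rw [pow_succ', mul_assoc ε, div_mul_eq_mul_div, mul_assoc ℓ]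
    simp only [cost, sum_add_distrib, ← mul_sum]
    rw [e1, e2, e3]
    have h2' := mul_le_mul_of_nonneg_left h2 hε.le
    have h3' := mul_le_mul_of_nonneg_left h3 hε.le
    linarith
  have htotal : ∑ i ∈ Ico (k - k) k, ∑ m ∈ M₀, cost i (2 * w m) ≤
      ε * (28 * (1 + 1 / c) + 4 * (D + 1)) * ∑ e ∈ M₀, w e := by
    rw [Nat.sub_self, ← range_eq_Ico, sum_comm, mul_sum]
    refine sum_le_sum fun m hm => ?_
    have := hcost (2 * w m) (by have := hw m (hM₀.1.1 m hm); positivity)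
    linarith
  have heq := le_antisymm hMM hMM'
  rw [heq]
  linarith

/-! ### Encoded memories and degenerate instances -/

namespace StreamingAlgorithm

/-- A streaming algorithm whose memory states form a type `T` embedded into `Memory s`. -/
def ofEncoding {n s : ℕ} {T : Type*} (enc : T → Memory s) (dec : Memory s → T) (init : T)
    (step : T → Sym2 (Fin n) × ℝ → T) (endPass : T → T)
    (output : T → Finset (Sym2 (Fin n) × ℝ)) : StreamingAlgorithm n s where
  init := enc init
  step σ x := enc (step (dec σ) x)
  endPass σ := enc (endPass (dec σ))
  output σ := output (dec σ)

theorem run_ofEncoding {n s : ℕ} {T : Type*} {enc : T → Memory s} {dec : Memory s → T}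
    (h : Function.LeftInverse dec enc) (init : T) (step : T → Sym2 (Fin n) × ℝ → T)
    (endPass : T → T) (output : T → Finset (Sym2 (Fin n) × ℝ)) (p : ℕ)
    (x : List (Sym2 (Fin n) × ℝ)) :
    (ofEncoding enc dec init step endPass output).run p x =
      output ((fun t => endPass (x.foldl step t))^[p] init) := by
  set A := ofEncoding enc dec init step endPass output
  have hfold : ∀ (x : List (Sym2 (Fin n) × ℝ)) (t : T),
      x.foldl A.step (enc t) = enc (x.foldl step t) := by
    intro x
    induction x with
    | nil => intro t; rfl
    | cons a x ih =>
      intro t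
      have : A.step (enc t) a = enc (step t a) := by simp [A, ofEncoding, h t]
      rw [List.foldl_cons, List.foldl_cons, this, ih]
  have hpass : Function.Semiconj enc (fun t => endPass (x.foldl step t)) (A.pass x) := by
    intro t
    simp only [pass, hfold]
    simp [A, ofEncoding, h (x.foldl step t)]
  have := (hpass.iterate_right p) init
  have hinit : A.init = enc init := rfl
  rw [run, hinit, ← this]
  simp [A, ofEncoding, h _]

/-- The algorithm that always outputs the empty matching. -/
def empty (n s : ℕ) : StreamingAlgorithm n s where
  init _ := false
  step σ _ := σ
  endPass σ := σ
  output _ := ∅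

theorem solvesMWM_empty_of_nonpos {n s p m : ℕ} {Ω : Finset ℝ} (hΩ : ∀ x ∈ Ω, 0 < x)
    {W α : ℝ} (hα : α ≤ 0) : (empty n s).SolvesMWM p m Ω W α := by
  intro G w l _ _ hw _
  refine ⟨∅, ⟨isEdgeMatching_empty G, fun M' hM' => ?_⟩, by simp [run, empty]⟩
  rw [sum_empty]
  exact mul_nonpos_of_nonpos_of_nonneg hα (sum_nonneg fun e he => (hΩ _ (hw e (hM'.1 e he))).le)

/-- The outputs on the graphs with at most one edge are all different. -/
theorem SolvesMWM.card_add_one_le {n s p m : ℕ} {A : StreamingAlgorithm n s} {Ω : Finset ℝ}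
    {W α : ℝ} (hA : A.SolvesMWM p m Ω W α) (hΩ : ∀ x ∈ Ω, 0 < x) (hα : 0 < α) (hW : 1 ≤ W)
    (hm : 1 ≤ m) {e : Sym2 (Fin n)} (he : ¬ e.IsDiag) : #Ω + 1 ≤ 2 ^ s := by
  classical
  have hsingle : ∀ x ∈ Ω, A.run p [(e, x)] = {(e, x)} := by
    intro x hx
    have hedge : (SimpleGraph.fromEdgeSet {e}).edgeSet = {e} := by
      rw [SimpleGraph.edgeSet_fromEdgeSet]
      ext f
      simp only [Set.mem_sdiff, Set.mem_singleton_iff, Sym2.mem_diagSet]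
      exact ⟨fun h => h.1, fun h => ⟨h, h ▸ he⟩⟩
    obtain ⟨M, hM, hrun⟩ := hA (SimpleGraph.fromEdgeSet {e}) (fun _ => x) [e]
      ⟨by simp, by simp [hedge]⟩ (by simpa using hm) (fun _ _ => hx)
      (fun _ _ _ _ => le_mul_of_one_le_left (hΩ x hx).le hW)
    have hsub : M ⊆ {e} := fun f hf => by simpa [hedge] using hM.1.1 f hf
    rcases subset_singleton_iff.1 hsub with rfl | rfl
    · have := hM.2 {e} ⟨by simp [hedge], by simp +contextual⟩
      simp only [sum_singleton, sum_empty] at this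
      exact absurd this (not_le.2 (mul_pos hα (hΩ x hx)))
    · apply coe_injective
      simpa using hrun
  have hnil : A.run p [] = ∅ := by
    obtain ⟨M, hM, hrun⟩ := hA ⊥ (fun _ => 1) [] ⟨by simp, by simp⟩ (by simp) (by simp)
      (by intro _ h; simp at h)
    have : M = ∅ := eq_empty_of_forall_notMem fun f hf => by simpa using hM.1.1 f hf
    subst this
    apply coe_injective
    simpa using hrun
  -- The output includes the weight, so the final memories on the empty stream and on the streams
  -- `[(e, x)]` are pairwise distinct.
  let f : Option Ω → Memory s := fun o =>
    (A.pass (o.elim [] fun x => [(e, (x : ℝ))]))^[p] A.init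
  have hf : Function.Injective f := by
    have hout : ∀ o, A.output (f o) = o.elim ∅ fun x => {(e, (x : ℝ))} := by
      rintro (_ | x)
      · exact hnil
      · exact hsingle x x.2
    intro o o' h
    have := (hout o).symm.trans ((congrArg A.output h).trans (hout o'))
    rcases o with _ | x <;> rcases o' with _ | y
    · rfl
    · exact absurd this.symm (singleton_ne_empty _)
    · exact absurd this (singleton_ne_empty _)
    · simp only [Option.elim_some, singleton_inj, Prod.mk.injEq, true_and] at this
      rw [Subtype.ext this]
  simpa using Fintype.card_le_of_injective f hf

/-- With so little memory no algorithm handles even one edge, so the hypothesis on `A` leaves only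
empty streams. -/
theorem solvesMWM_empty_of_card {n s s' p m : ℕ} {A : StreamingAlgorithm n s} {Ω : Finset ℝ}
    {W W' α α' : ℝ} (hA : A.SolvesMWM p m Ω W α) (hΩ : ∀ x ∈ Ω, 0 < x) (hα : 0 < α)
    (hW : 1 ≤ W) (hs : ¬ #Ω + 1 ≤ 2 ^ s) : (empty n s').SolvesMWM p m Ω W' α' := by
  intro G w l hl hm _ _
  rcases l with _ | ⟨e, l⟩
  · have hG : ∀ e, e ∉ G.edgeSet := fun e he => by simpa using (hl.2 e).2 he
    refine ⟨∅, ⟨isEdgeMatching_empty G, fun M' hM' => ?_⟩, by simp [run, empty]⟩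
    rw [eq_empty_of_forall_notMem fun e he => hG e (hM'.1 e he)]
    simp
  · exact absurd (hA.card_add_one_le hΩ hα hW (by simp at hm; omega)
      (G.not_isDiag_of_mem_edgeSet ((hl.2 e).1 (by simp)))) hs

end StreamingAlgorithm

/-! ### The best matching in a set of weighted edges -/

theorem exists_bestMatching {V : Type*} (U : Finset (Sym2 V × ℝ)) :
    ∃ S ⊆ U, (∀ x ∈ S, ∀ y ∈ S, ∀ v : V, v ∈ x.1 → v ∈ y.1 → x = y) ∧
      ∀ S' ⊆ U, (∀ x ∈ S', ∀ y ∈ S', ∀ v : V, v ∈ x.1 → v ∈ y.1 → x = y) →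
        ∑ x ∈ S', x.2 ≤ ∑ x ∈ S, x.2 := by
  classical
  obtain ⟨S, hS, hmax⟩ := (U.powerset.filter
    (fun S => ∀ x ∈ S, ∀ y ∈ S, ∀ v : V, v ∈ x.1 → v ∈ y.1 → x = y)).exists_max_image
    (fun S => ∑ x ∈ S, x.2) ⟨∅, by simp⟩
  simp only [mem_filter, mem_powerset] at hS hmax
  exact ⟨S, hS.1, hS.2, fun S' h1 h2 => hmax S' ⟨h1, h2⟩⟩

/-- A maximum weight matching consisting of edges of `U`. -/
noncomputable def bestMatching {V : Type*} (U : Finset (Sym2 V × ℝ)) : Finset (Sym2 V × ℝ) :=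
  (exists_bestMatching U).choose

theorem exists_bestMatching_eq_image {V : Type*} {G : SimpleGraph V} {w : Sym2 V → ℝ}
    {U : Finset (Sym2 V × ℝ)} (hU : ∀ x ∈ U, x.1 ∈ G.edgeSet ∧ x.2 = w x.1) :
    ∃ M : Finset (Sym2 V), IsEdgeMatching G M ∧
      (bestMatching U : Set (Sym2 V × ℝ)) = (fun e => (e, w e)) '' (M : Set (Sym2 V)) ∧
      ∀ N : Finset (Sym2 V), IsEdgeMatching G N → (∀ e ∈ N, (e, w e) ∈ U) →
        ∑ e ∈ N, w e ≤ ∑ e ∈ M, w e := by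
  classical
  obtain ⟨hSU, hS, hmax⟩ := (exists_bestMatching U).choose_spec
  change bestMatching U ⊆ U at hSU
  change ∀ x ∈ bestMatching U, _ at hS
  change ∀ S' ⊆ U, _ → _ ≤ ∑ x ∈ bestMatching U, x.2 at hmax
  set S := bestMatching U
  have hinj : Set.InjOn Prod.fst (S : Set (Sym2 V × ℝ)) := fun x hx y hy h =>
    Prod.ext h (by rw [(hU x (hSU hx)).2, (hU y (hSU hy)).2, h])
  have hsum : ∑ e ∈ S.image Prod.fst, w e = ∑ x ∈ S, x.2 := by
    rw [sum_image hinj]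
    exact sum_congr rfl fun x hx => (hU x (hSU hx)).2.symm
  refine ⟨S.image Prod.fst, ⟨?_, ?_⟩, ?_, fun N hN hNU => ?_⟩
  · intro e he
    obtain ⟨x, hx, rfl⟩ := mem_image.1 he
    exact (hU x (hSU hx)).1
  · intro e he f hf v hve hvf
    obtain ⟨x, hx, rfl⟩ := mem_image.1 he
    obtain ⟨y, hy, rfl⟩ := mem_image.1 hf
    rw [hS x hx y hy v hve hvf]
  · ext x
    simp only [coe_image, Set.mem_image, mem_coe]
    constructor
    · intro hx
      exact ⟨x.1, ⟨x, hx, rfl⟩, Prod.ext rfl (hU x (hSU hx)).2.symm⟩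
    · rintro ⟨_, ⟨y, hy, rfl⟩, rfl⟩
      rwa [← (hU y (hSU hy)).2]
  · rw [hsum]
    have := hmax (N.image fun e => (e, w e)) (by
        intro x hx
        obtain ⟨e, he, rfl⟩ := mem_image.1 hx
        exact hNU e he) (by
        intro x hx y hy v hvx hvy
        obtain ⟨e, he, rfl⟩ := mem_image.1 hx
        obtain ⟨f, hf, rfl⟩ := mem_image.1 hy
        rw [hN.2 e he f hf v hvx hvy])
    rwa [sum_image (by intro a _ b _ h; exact (Prod.mk.inj h).1)] at this

/-! ### Running copies in parallel -/

namespace StreamingAlgorithm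

section Parallel

open scoped Classical in
/-- One step of `k` copies of `A`, where the copy `i` reads only the edges whose weight `y`
satisfies `P x₀ i y`. Here `x₀` is the first weight of the stream, which is remembered. -/
noncomputable def parallelStep {n s k : ℕ} (A : StreamingAlgorithm n s) (Ω : Finset ℝ)
    (P : ℝ → Fin k → ℝ → Prop) (t : Option Ω × (Fin k → Memory s)) (z : Sym2 (Fin n) × ℝ) :
    Option Ω × (Fin k → Memory s) :=
  -- `Option.or` keeps a weight that is already stored. The updated `o` is used at once, so the very
  -- first edge is also routed to its windows.
  let o : Option Ω := t.1.or (if h : z.2 ∈ Ω then some ⟨z.2, h⟩ else none)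
  (o, fun i => if ∃ x₀ ∈ o, P x₀ i z.2 then A.step (t.2 i) z else t.2 i)

open scoped Classical in
theorem foldl_parallelStep_some {n s k : ℕ} (A : StreamingAlgorithm n s) (Ω : Finset ℝ)
    (P : ℝ → Fin k → ℝ → Prop) (x₀ : Ω) (x : List (Sym2 (Fin n) × ℝ))
    (σ : Fin k → Memory s) :
    x.foldl (A.parallelStep Ω P) (some x₀, σ) =
      (some x₀, fun i => (x.filter fun z => P x₀ i z.2).foldl A.step (σ i)) := by
  induction x generalizing σ with
  | nil => rfl
  | cons z x ih =>
    have : A.parallelStep Ω P (some x₀, σ) z =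
        (some x₀, fun i => if P x₀ i z.2 then A.step (σ i) z else σ i) := by
      simp [parallelStep]
    rw [List.foldl_cons, this, ih]
    congr 1
    funext i
    by_cases h : P x₀ i z.2 <;> simp [h]

open scoped Classical in
-- In later passes the stored weight is still that of the head of the stream, so every pass applies
-- the same filters.
theorem iterate_parallelStep {n s k : ℕ} (A : StreamingAlgorithm n s) (Ω : Finset ℝ)
    (P : ℝ → Fin k → ℝ → Prop) (x₀ : ℝ) (x : List (Sym2 (Fin n) × ℝ))
    (hx : ∀ z ∈ x, z.2 ∈ Ω) (hx₀ : ∀ z ∈ x.head?, z.2 = x₀) (p : ℕ) (i : Fin k) :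
    ((fun t : Option Ω × (Fin k → Memory s) =>
        ((x.foldl (A.parallelStep Ω P) t).1,
          fun i => A.endPass ((x.foldl (A.parallelStep Ω P) t).2 i)))^[p]
        (none, fun _ => A.init)).2 i =
      (A.pass (x.filter fun z => P x₀ i z.2))^[p] A.init := by
  set Φ := fun t : Option Ω × (Fin k → Memory s) =>
        ((x.foldl (A.parallelStep Ω P) t).1,
          fun i => A.endPass ((x.foldl (A.parallelStep Ω P) t).2 i)) with hΦ
  have hstep : ∀ (o : Option Ω) (σ : Fin k → Memory s), (∀ y ∈ o, (y : ℝ) = x₀) →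
      (∀ y ∈ (Φ (o, σ)).1, (y : ℝ) = x₀) ∧
      (Φ (o, σ)).2 = fun i => A.pass (x.filter fun z => P x₀ i z.2) (σ i) := by
    intro o σ ho
    rcases x with _ | ⟨z, x⟩
    · exact ⟨ho, rfl⟩
    · have hz : z.2 = x₀ := hx₀ z (by simp)
      have hzΩ : x₀ ∈ Ω := hz ▸ hx z (by simp)
      have hfold : (z :: x).foldl (A.parallelStep Ω P) (o, σ) =
          (z :: x).foldl (A.parallelStep Ω P) (some ⟨x₀, hzΩ⟩, σ) := by
        rcases o with _ | y
        · rw [List.foldl_cons, List.foldl_cons]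
          congr 1
          simp [parallelStep, hz, hzΩ]
        · have : y = ⟨x₀, hzΩ⟩ := Subtype.ext (ho y rfl)
          rw [this]
      simp only [hΦ, hfold, foldl_parallelStep_some]
      exact ⟨by simp, rfl⟩
  have hall : ∀ p, (∀ y ∈ (Φ^[p] (none, fun _ => A.init)).1, (y : ℝ) = x₀) ∧
      (Φ^[p] (none, fun _ => A.init)).2 =
        fun i => (A.pass (x.filter fun z => P x₀ i z.2))^[p] A.init := by
    intro p
    induction p with
    | zero => exact ⟨by simp, rfl⟩
    | succ p ih =>
      rw [Function.iterate_succ_apply']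
      obtain ⟨h1, h2⟩ := ih
      obtain ⟨h3, h4⟩ := hstep _ (Φ^[p] (none, fun _ => A.init)).2 h1
      refine ⟨h3, ?_⟩
      rw [Prod.mk.eta] at h4
      rw [h4, h2]
      funext i
      rw [Function.iterate_succ_apply']
  rw [(hall p).2]

open scoped Classical in
/-- Running copies of `A` in parallel on parts of the stream selected by the weight relative to
the first weight, and outputting the best matching contained in the union of their outputs. -/
theorem exists_parallel {n s : ℕ} (k : ℕ) (A : StreamingAlgorithm n s) {Ω : Finset ℝ}
    (hΩ : #Ω + 1 ≤ 2 ^ s) (P : ℝ → Fin k → ℝ → Prop) :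
    ∃ A' : StreamingAlgorithm n ((k + 1) * s), ∀ (p : ℕ) (x : List (Sym2 (Fin n) × ℝ)) (x₀ : ℝ),
      (∀ z ∈ x, z.2 ∈ Ω) → (∀ z ∈ x.head?, z.2 = x₀) →
      ∃ U : Finset (Sym2 (Fin n) × ℝ), A'.run p x = bestMatching U ∧
        ∀ z, z ∈ U ↔ ∃ i, z ∈ A.run p (x.filter fun z => P x₀ i z.2) := by
  have hcard : Fintype.card (Option Ω × (Fin k → Memory s)) ≤
      Fintype.card (Memory ((k + 1) * s)) := by
    simp only [Fintype.card_prod, Fintype.card_option, Fintype.card_coe, Fintype.card_pi_const,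
      Fintype.card_bool]
    -- The stored weight takes the place of one further memory of `s` bits.
    calc (#Ω + 1) * (2 ^ s) ^ k ≤ 2 ^ s * (2 ^ s) ^ k := by gcongr
      _ = _ := by rw [← pow_succ', ← pow_mul, mul_comm]
  obtain ⟨enc⟩ := Function.Embedding.nonempty_of_card_le hcard
  refine ⟨ofEncoding enc (Function.invFun enc) (none, fun _ => A.init) (A.parallelStep Ω P)
    (fun t => (t.1, fun i => A.endPass (t.2 i)))
    (fun t => bestMatching (univ.biUnion fun i => A.output (t.2 i))), fun p x x₀ hx hx₀ => ?_⟩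
  rw [run_ofEncoding (Function.leftInverse_invFun enc.injective)]
  refine ⟨_, rfl, fun z => ?_⟩
  simp only [mem_biUnion, mem_univ, true_and]
  refine exists_congr fun i => ?_
  rw [iterate_parallelStep A Ω P x₀ x hx hx₀ p i, run]

end Parallel

end StreamingAlgorithm

/-! ### Restriction to windows and reduction of the aspect ratio -/

theorem mem_edgeSet_fromEdgeSet_iff {V : Type*} {G : SimpleGraph V} {Q : Sym2 V → Prop}
    {e : Sym2 V} : e ∈ (SimpleGraph.fromEdgeSet {e ∈ G.edgeSet | Q e}).edgeSet ↔
      e ∈ G.edgeSet ∧ Q e := by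
  rw [SimpleGraph.edgeSet_fromEdgeSet]
  exact ⟨fun h => h.1, fun h => ⟨h, G.not_isDiag_of_mem_edgeSet h.1⟩⟩

theorem isEdgeMatching_fromEdgeSet_iff {V : Type*} {G : SimpleGraph V} {Q : Sym2 V → Prop}
    {M : Finset (Sym2 V)} :
    IsEdgeMatching (SimpleGraph.fromEdgeSet {e ∈ G.edgeSet | Q e}) M ↔
      IsEdgeMatching G M ∧ ∀ e ∈ M, Q e := by
  simp only [IsEdgeMatching, mem_edgeSet_fromEdgeSet_iff]
  grind

open scoped Classical in
/-- Running an algorithm on the edges whose weight satisfies `Q`. -/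
theorem StreamingAlgorithm.SolvesMWM.run_filter {n s p m : ℕ} {A : StreamingAlgorithm n s}
    {Ω : Finset ℝ} {W α : ℝ} (hA : A.SolvesMWM p m Ω W α) {G : SimpleGraph (Fin n)}
    {w : Sym2 (Fin n) → ℝ} {l : List (Sym2 (Fin n))} (hl : IsEdgeOrdering G l)
    (hlm : l.length ≤ m) (hw : ∀ e ∈ G.edgeSet, w e ∈ Ω) {Q : ℝ → Prop}
    (hQ : ∀ x y, Q x → Q y → x ≤ W * y) :
    ∃ M : Finset (Sym2 (Fin n)), IsEdgeMatching G M ∧ (∀ e ∈ M, Q (w e)) ∧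
      (∀ M', IsEdgeMatching G M' → (∀ e ∈ M', Q (w e)) →
        α * ∑ e ∈ M', w e ≤ ∑ e ∈ M, w e) ∧
      ∀ z, z ∈ A.run p ((l.map fun e => (e, w e)).filter fun z => Q z.2) ↔
        z.1 ∈ M ∧ z.2 = w z.1 := by
  obtain ⟨M, hM, hrun⟩ := hA (SimpleGraph.fromEdgeSet {e ∈ G.edgeSet | Q (w e)}) w
    (l.filter fun e => Q (w e))
    ⟨hl.1.filter _, fun e => by
      rw [mem_edgeSet_fromEdgeSet_iff, List.mem_filter, hl.2, decide_eq_true_iff]⟩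
    ((List.length_filter_le _ _).trans hlm)
    (fun e he => hw e (mem_edgeSet_fromEdgeSet_iff.1 he).1)
    (fun e he f hf => hQ _ _ (mem_edgeSet_fromEdgeSet_iff.1 he).2
      (mem_edgeSet_fromEdgeSet_iff.1 hf).2)
  have hM' := isEdgeMatching_fromEdgeSet_iff.1 hM.1
  refine ⟨M, hM'.1, hM'.2, fun M' h1 h2 =>
    hM.2 M' (isEdgeMatching_fromEdgeSet_iff.2 ⟨h1, h2⟩), fun z => ?_⟩
  have hfm : (l.map fun e => (e, w e)).filter (fun z => Q z.2) =
      (l.filter fun e => Q (w e)).map fun e => (e, w e) := by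
    rw [List.filter_map]
    rfl
  rw [hfm, ← mem_coe, hrun]
  simp only [Set.mem_image, mem_coe]
  constructor
  · rintro ⟨e, he, rfl⟩
    exact ⟨he, rfl⟩
  · rintro ⟨h1, h2⟩
    exact ⟨z.1, h1, Prod.ext rfl h2.symm⟩

/-- Parallel composition over weight windows reduces the aspect ratio from `W` to `q / ε ^ 2`. -/
theorem exists_solvesMWM_of_windows {n s p m : ℕ} {A : StreamingAlgorithm n s} {Ω : Finset ℝ}
    {ε q c W : ℝ} (hΩ : ∀ x ∈ Ω, 0 < x) (hcard : #Ω + 1 ≤ 2 ^ s) (hε : 0 < ε) (hε1 : ε ≤ 1)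
    (hc : 0 < c) (hq : 1 + c ≤ q) (hqε : q / ε ^ 2 ≤ q ^ (1 + 2 / c)) (hW : 1 ≤ W)
    (hα : 0 ≤ 1 - 36 * (1 + 1 / c) * ε) (k : ℕ) (hk : W ^ 2 < q ^ k)
    (hA : A.SolvesMWM p m Ω (q / ε ^ 2) (1 - ε)) :
    ∃ A' : StreamingAlgorithm n ((k + 1) * s),
      A'.SolvesMWM p m Ω W (1 - 36 * (1 + 1 / c) * ε) := by
  classical
  -- The least weight is unknown to the algorithm, but every weight lies between `x₀ / W` and `x₀ *
  -- W`. So `x₀ / W` serves as `ℓ`, and the classes have to cover a ratio of `W ^ 2`.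
  obtain ⟨P, hP⟩ : ∃ P : ℝ → Fin k → ℝ → Prop, ∀ x₀ i y, P x₀ i y ↔
      ε * (x₀ / W * q ^ (i : ℕ)) ≤ y ∧ y < x₀ / W * q ^ ((i : ℕ) + 1) / ε :=
    ⟨_, fun _ _ _ => Iff.rfl⟩
  have hq0 : 0 < q := by linarith
  have hW0 : 0 < W := by linarith
  obtain ⟨A', hA'⟩ := A.exists_parallel k hcard P
  refine ⟨A', fun G w l hl hlm hw hGW => ?_⟩
  have hwpos : ∀ e ∈ G.edgeSet, 0 < w e := fun e he => hΩ _ (hw e he)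
  obtain ⟨x₀, hx₀, hx₀l, hx₀G⟩ : ∃ x₀ : ℝ, 0 < x₀ ∧
      (∀ z ∈ (l.map fun e => (e, w e)).head?, z.2 = x₀) ∧
      ∀ e ∈ G.edgeSet, w e ≤ W * x₀ ∧ x₀ ≤ W * w e := by
    rcases l with _ | ⟨f, l⟩
    · exact ⟨1, one_pos, by simp, fun e he => by simpa using (hl.2 e).2 he⟩
    · have hf : f ∈ G.edgeSet := (hl.2 f).1 (by simp)
      exact ⟨w f, hwpos f hf, by simp, fun e he => ⟨hGW e he f hf, hGW f hf e he⟩⟩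
  obtain ⟨U, hrun, hU⟩ := hA' p (l.map fun e => (e, w e)) x₀ (by
    intro z hz
    obtain ⟨e, he, rfl⟩ := List.mem_map.1 hz
    exact hw e ((hl.2 e).1 he)) hx₀l
  have hℓ : 0 < x₀ / W := by positivity
  have hPW : ∀ (i : Fin k) x y, P x₀ i x → P x₀ i y → x ≤ q / ε ^ 2 * y := by
    intro i x y hx hy
    rw [hP] at hx hy
    calc x ≤ x₀ / W * q ^ ((i : ℕ) + 1) / ε := hx.2.le
      _ = q / ε ^ 2 * (ε * (x₀ / W * q ^ (i : ℕ))) := by field_simp; ring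
      _ ≤ _ := by gcongr; exact hy.1
  choose H hH hHw hopt hHrun using fun i : Fin k =>
    hA.run_filter hl hlm hw (Q := P x₀ i) (hPW i)
  have hUG : ∀ z ∈ U, z.1 ∈ G.edgeSet ∧ z.2 = w z.1 := by
    intro z hz
    obtain ⟨i, hi⟩ := (hU z).1 hz
    obtain ⟨h1, h2⟩ := (hHrun i z).1 hi
    exact ⟨(hH i).1 _ h1, h2⟩
  obtain ⟨M, hM, hMrun, hMmax⟩ := exists_bestMatching_eq_image hUG
  refine ⟨M, ⟨hM, fun M' hM' => ?_⟩, by rw [hrun, hMrun]⟩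
  let H' : ℕ → Finset (Sym2 (Fin n)) := fun i => if h : i < k then H ⟨i, h⟩ else ∅
  have hH' : ∀ i (h : i < k), H' i = H ⟨i, h⟩ := fun i h => dif_pos h
  obtain ⟨N, hN, hNH, hNw⟩ := exists_matching_composition (G := G) (w := w) hwpos hε hε1 hℓ hc hq
    (D := 1 + 2 / c) (by positivity) hqε k
    (fun e he => by
      obtain ⟨h1, h2⟩ := hx₀G e he
      refine ⟨by rw [div_le_iff₀ hW0]; linarith, ?_⟩
      calc w e ≤ W * x₀ := h1
        _ = x₀ / W * W ^ 2 := by field_simp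
        _ < _ := by gcongr) H'
    (fun i hi => hH' i hi ▸ hH ⟨i, hi⟩)
    (fun i hi e he => by
      rw [hH' i hi] at he
      exact (hP _ _ _).1 (hHw ⟨i, hi⟩ e he))
    (fun i hi X hX hXw => by
      rw [hH' i hi]
      exact hopt ⟨i, hi⟩ X hX fun e he => (hP _ _ _).2 (hXw e he))
  obtain ⟨M₀, hM₀⟩ := exists_max_edgeMatching G w
  have h1 := hNw M₀ hM₀
  have h2 := hM₀.2 M' hM'
  have h3 := hMmax N hN fun e he => by
    obtain ⟨i, hi, hei⟩ := hNH e he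
    rw [hH' i hi] at hei
    exact (hU _).2 ⟨⟨i, hi⟩, (hHrun _ _).2 ⟨hei, rfl⟩⟩
  rw [one_mul] at h2
  -- With `D = 1 + 2 / c` the term `4 * (D + 1)` is `8 * (1 + 1 / c)`, whence 36 = 28 + 8.
  calc _ ≤ (1 - 36 * (1 + 1 / c) * ε) * ∑ e ∈ M₀, w e := by gcongr
    _ = (1 - ε * (28 * (1 + 1 / c) + 4 * (1 + 2 / c + 1))) * ∑ e ∈ M₀, w e := by ring
    _ ≤ _ := h1.trans h3

/-! ### Space bounds and conclusion -/

/-- The number of weight classes used for aspect ratio `W`. -/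
noncomputable def numWindows (ε c W : ℝ) : ℕ := ⌊2 / c * Real.logb (1 / ε) W⌋₊ + 1

theorem sq_lt_rpow_numWindows {ε c W : ℝ} (hε : 0 < ε) (hε1 : ε < 1) (hc : 0 < c) (hW : 1 ≤ W) :
    W ^ 2 < (ε ^ (-c)) ^ numWindows ε c W := by
  have h1 : 1 < 1 / ε := by rw [lt_div_iff₀ hε]; linarith
  have hfloor := Nat.lt_floor_add_one (2 / c * Real.logb (1 / ε) W)
  have h2 : ε ^ (-c) = (1 / ε) ^ c := by rw [one_div, Real.inv_rpow hε.le, Real.rpow_neg hε.le]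
  have hW' : W = (1 / ε) ^ Real.logb (1 / ε) W :=
    (Real.rpow_logb (by positivity) h1.ne' (by linarith)).symm
  have h3 : W ^ 2 = (1 / ε) ^ (2 * Real.logb (1 / ε) W) := by
    conv_lhs => rw [hW']
    rw [← Real.rpow_natCast, ← Real.rpow_mul (by positivity)]
    push_cast
    rw [mul_comm]
  rw [h2, h3, ← Real.rpow_natCast, ← Real.rpow_mul (by positivity)]
  refine Real.rpow_lt_rpow_of_exponent_lt h1 ?_
  rw [numWindows]
  push_cast
  calc 2 * Real.logb (1 / ε) W = c * (2 / c * Real.logb (1 / ε) W) := by field_simp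
    _ < _ := by gcongr

theorem numWindows_add_one_le {ε c W : ℝ} (hε : 0 < ε) (hε1 : ε < 1) (hc : 0 < c) (hW : 1 ≤ W) :
    (numWindows ε c W + 1 : ℝ) ≤ (2 + 2 / c) * (1 + Real.logb (1 / ε) W) := by
  have h1 : 1 < 1 / ε := by rw [lt_div_iff₀ hε]; linarith
  have hlog : 0 ≤ Real.logb (1 / ε) W := Real.logb_nonneg h1 hW
  have hfloor := Nat.floor_le (a := 2 / c * Real.logb (1 / ε) W) (by positivity)
  have : 0 ≤ 2 / c := by positivity
  rw [numWindows]
  push_cast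
  nlinarith

/-- The constant `W₀` is at most a fixed power of `n ≥ 2`, and for polynomially bounded `W` the
factor `1 + Real.logb b W` costs one more power of `Real.log n`. -/
theorem IsSemiStreamingSpace.of_le {s s' : ℕ → ℕ → ℝ → ℕ} (hs : IsSemiStreamingSpace s)
    {K W₀ b : ℝ} (hK : 0 ≤ K) (hW₀ : 1 ≤ W₀) (hb : 1 < b)
    (h : ∀ (n m : ℕ) (W : ℝ), 1 ≤ W →
      (s' n m W : ℝ) ≤ K * (s n m W₀ * (1 + Real.logb b W))) : IsSemiStreamingSpace s' := by
  intro d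
  obtain ⟨d₀, hd₀⟩ := pow_unbounded_of_one_lt W₀ (one_lt_two : (1 : ℝ) < 2)
  obtain ⟨C, k, hC⟩ := hs d₀
  have hlb : 0 < Real.log b := Real.log_pos hb
  have hl2 : 0 < Real.log 2 := Real.log_pos one_lt_two
  refine ⟨K * C * (1 / Real.log 2 + d / Real.log b), k + 1, fun n m W hn hm hW hWd => ?_⟩
  have hn' : (2 : ℝ) ≤ n := by exact_mod_cast hn
  have hln : Real.log 2 ≤ Real.log n := Real.log_le_log two_pos hn'
  have h1 := hC n m W₀ hn hm hW₀ (hd₀.le.trans (by gcongr))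
  have h2 : Real.logb b W ≤ d / Real.log b * Real.log n := by
    rw [Real.logb, div_mul_eq_mul_div]
    gcongr
    calc Real.log W ≤ Real.log ((n : ℝ) ^ d) := Real.log_le_log (by linarith) hWd
      _ = _ := by rw [Real.log_pow]
  have h3 : 1 ≤ 1 / Real.log 2 * Real.log n := by
    rw [one_div, inv_mul_eq_div, le_div_iff₀ hl2]
    linarith
  have h4 : 0 ≤ Real.logb b W := Real.logb_nonneg hb hW
  calc (s' n m W : ℝ) ≤ K * (s n m W₀ * (1 + Real.logb b W)) := h n m W hW
    _ ≤ K * ((C * (n * Real.log n ^ k)) * ((1 / Real.log 2 + d / Real.log b) * Real.log n)) := by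
        have h5 : 0 ≤ C * (n * Real.log n ^ k) := le_trans (Nat.cast_nonneg _) h1
        gcongr
        linarith
    _ = _ := by ring

theorem mainTheorem12 :
    ∃ C : ℝ, 0 < C ∧ ∀ c : ℝ, 0 < c →
      ∃ (K : ℝ) (W₀ : ℝ → ℝ), 0 < K ∧
        (∀ ε : ℝ, 0 < ε → ε < 1 →
          K⁻¹ * ε ^ (-(2 + c)) ≤ W₀ ε ∧ W₀ ε ≤ K * ε ^ (-(2 + c))) ∧
        ∀ (Ω : ℕ → Finset ℝ), (∀ n, ∀ x ∈ Ω n, 0 < x) →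
          ∀ (p s : ℕ → ℕ → ℝ → ℝ → ℕ) (ε : ℝ), 0 < ε → ε < 1 →
            HasSemiStreamingMWM Ω (1 - ε)
              (fun n m W => p n m W ε) (fun n m W => s n m W ε) →
            ∃ s' : ℕ → ℕ → ℝ → ℕ,
              (∀ (n m : ℕ) (W : ℝ), 1 ≤ W →
                (s' n m W : ℝ) ≤
                  K * (s n m (W₀ ε) ε * (1 + Real.logb (1 / ε) W))) ∧
              HasSemiStreamingMWM Ω (1 - C * (1 + 1 / c) * ε)
                (fun n m _ => p n m (W₀ ε) ε) s' := by

  classical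
  refine ⟨36, by norm_num, fun c hc => ⟨2 + 2 / c, fun ε => ε ^ (-(2 + c)), by positivity, ?_, ?_⟩⟩
  · intro ε hε _
    have hK : 1 ≤ 2 + 2 / c := by
      have : 0 < 2 / c := by positivity
      linarith
    have hpos : 0 ≤ ε ^ (-(2 + c)) := by positivity
    exact ⟨mul_le_of_le_one_left hpos (inv_le_one_of_one_le₀ hK), le_mul_of_one_le_left hpos hK⟩
  · intro Ω hΩ p s ε hε hε1 hA
    obtain ⟨hs, hA⟩ := hA
    have hb : 1 < 1 / ε := by rw [lt_div_iff₀ hε]; linarith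
    have hlog : ∀ W : ℝ, 1 ≤ W → 0 ≤ Real.logb (1 / ε) W := fun W hW => Real.logb_nonneg hb hW
    have hW₀ : 1 ≤ ε ^ (-(2 + c)) :=
      Real.one_le_rpow_of_pos_of_le_one_of_nonpos hε hε1.le (by linarith)
    beta_reduce
    suffices hsuff : ∃ s' : ℕ → ℕ → ℝ → ℕ,
        (∀ (n m : ℕ) (W : ℝ), 1 ≤ W → (s' n m W : ℝ) ≤
          (2 + 2 / c) * (s n m (ε ^ (-(2 + c))) ε * (1 + Real.logb (1 / ε) W))) ∧
        ∀ (n m : ℕ) (W : ℝ), 1 ≤ W → ∃ A : StreamingAlgorithm n (s' n m W),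
          A.SolvesMWM (p n m (ε ^ (-(2 + c))) ε) m (Ω n) W (1 - 36 * (1 + 1 / c) * ε) by
      obtain ⟨s', h1, h2⟩ := hsuff
      exact ⟨s', h1, hs.of_le (by positivity) hW₀ hb h1, h2⟩
    -- For large `ε` the guarantee is void and the empty matching suffices. Otherwise `ε ≤ 1 / 36 <
    -- 1 / e`, so that `ε ^ (-c) ≥ exp c ≥ 1 + c` makes the classes grow fast enough.
    by_cases hα : 1 - 36 * (1 + 1 / c) * ε ≤ 0
    · refine ⟨fun _ _ _ => 0, fun n m W hW => ?_, fun n m W _ =>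
        ⟨_, StreamingAlgorithm.solvesMWM_empty_of_nonpos (hΩ n) hα⟩⟩
      have := hlog W hW
      rw [Nat.cast_zero]
      positivity
    · push Not at hα
      have hε36 : 36 * ε ≤ 1 := by
        have : 0 < 1 / c * ε := by positivity
        linarith
      have hq : 1 + c ≤ ε ^ (-c) := by
        have hle : ε ≤ Real.exp (-1) := by
          have h3 : Real.exp 1 < 3 := Real.exp_one_lt_three
          rw [Real.exp_neg, ← one_div, le_div_iff₀ (Real.exp_pos 1)]
          nlinarith
        calc 1 + c ≤ Real.exp c := by linarith [Real.add_one_le_exp c]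
          _ = Real.exp (-1) ^ (-c) := by rw [← Real.exp_mul]; ring_nf
          _ ≤ ε ^ (-c) := Real.rpow_le_rpow_of_nonpos hε hle (by linarith)
      have hqW : ε ^ (-c) / ε ^ 2 = ε ^ (-(2 + c)) := by
        rw [← Real.rpow_natCast, ← Real.rpow_sub hε]
        congr 1
        push_cast
        ring
      have hqε : ε ^ (-c) / ε ^ 2 ≤ (ε ^ (-c)) ^ (1 + 2 / c) := by
        rw [hqW, ← Real.rpow_mul hε.le]
        refine le_of_eq (congrArg _ ?_)
        field_simp
        ring
      -- One memory per window and one for the first weight; no memory at all when only empty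
      -- streams can occur.
      refine ⟨fun n m W => if #(Ω n) + 1 ≤ 2 ^ s n m (ε ^ (-(2 + c))) ε then
        (numWindows ε c W + 1) * s n m (ε ^ (-(2 + c))) ε else 0,
        fun n m W hW => ?_, fun n m W hW => ?_⟩
      · have := hlog W hW
        beta_reduce
        split_ifs
        · push_cast
          have := numWindows_add_one_le hε hε1 hc hW
          calc _ ≤ (2 + 2 / c) * (1 + Real.logb (1 / ε) W) *
                (s n m (ε ^ (-(2 + c))) ε : ℝ) := by gcongr
            _ = _ := by ring
        · rw [Nat.cast_zero]
          positivity
      · obtain ⟨A, hA⟩ := hA n m _ hW₀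
        beta_reduce at hA ⊢
        by_cases hcard : #(Ω n) + 1 ≤ 2 ^ s n m (ε ^ (-(2 + c))) ε
        · rw [if_pos hcard]
          exact exists_solvesMWM_of_windows (hΩ n) hcard hε hε1.le hc hq hqε hW hα.le _
            (sq_lt_rpow_numWindows hε hε1 hc hW) (by rw [hqW]; exact hA)
        · exact ⟨_, StreamingAlgorithm.solvesMWM_empty_of_card hA (hΩ n) (by linarith) hW₀ hcard⟩
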